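/- For a sequence $r=(r_n)_{n\ge 0}$ of positive reals strictly decreasing to $0$ with $r_{n+1}\le\frac12 r_n$ for all $n$, let $\mathsf C(r)\subseteq\mathbb R$ denote the symmetric Cantor set defined as follows: $I_\emptyset=[0,r_0]$; if $p$ is a binary word of length $n$ and the closed interval $I_p$ of length $r_n$ has been defined, then $I_{p0}$ and $I_{p1}$ are the closed intervals of length $r_{n+1}$ such that $I_{p0}$ has the same left endpoint as $I_p$ and $I_{p1}$ has the same right endpoint as $I_p$; and $\mathsf C(r)=\bigcap_{n\ge 0}\bigcup\{I_p : p\in\{0,1\}^n\}$. Let $\mathcal{CS}$ be the family of all sets $\mathsf C(r)$ of this form. For $f:\{0,1,2,\dots\}\to[1,\infty)$ let $$\mathcal M(f)=\{\mathsf C(r)\in\mathcal{CS} : \text{for every } \varepsilon>0 \text{ there are infinitely many } n \text{ with } r_n<\varepsilon^{f(n)}\}.$$ A set $A\subseteq\mathbb R$ is microscopic if for every $\varepsilon>0$ there is a countable cover $E_1,E_2,\dots$ of $A$ with $\operatorname{diam}E_n<\varepsilon^n$ for all $n\ge1$. Then $$\mathcal M(2^n)\subsetneq\{A\in\mathcal{CS}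 : A \text{ is microscopic}\}\subsetneq\bigcap_{1<p<2}\mathcal M(p^n),$$ where $p$ ranges over the real numbers in $(1,2)$. -/

import Mathlib

open Filter Topology

namespace CantorMicro

/-- The sequences `r` that induce a symmetric Cantor set: sequences of positive reals that strictly
decrease to `0` and satisfy `r (n + 1) ≤ r n / 2` for all `n`. -/
structure IsAdmissible (r : ℕ → ℝ) : Prop where
  pos : ∀ n, 0 < r n
  strictAnti : StrictAnti r
  tendsto_zero : Tendsto r atTop (𝓝 0)
  le_half : ∀ n, r (n + 1) ≤ r n / 2

/-- The left endpoint of the interval `I_p`, for a binary word `p` of length `n`. The interval of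
the empty word starts at `0`; `I_{p0}` shares its left endpoint with `I_p`, and `I_{p1}`, which has
length `r (n + 1)`, shares its right endpoint with `I_p`, which has length `r n`. -/
noncomputable def leftEnd (r : ℕ → ℝ) : (n : ℕ) → (Fin n → Bool) → ℝ
  | 0, _ => 0
  | n + 1, p =>
      leftEnd r n (Fin.init p) + (if p (Fin.last n) = true then r n - r (n + 1) else 0)

/-- The closed interval `I_p` of length `r n`, for a binary word `p` of length `n`. -/
noncomputable def cantorInterval (r : ℕ → ℝ) (n : ℕ) (p : Fin n → Bool) : Set ℝ :=
  Set.Icc (leftEnd r n p) (leftEnd r n p + r n)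

/-- The symmetric Cantor set `C(r) = ⋂ n, ⋃ {I_p : p a binary word of length n}`. -/
noncomputable def symmCantor (r : ℕ → ℝ) : Set ℝ :=
  ⋂ n : ℕ, ⋃ p : Fin n → Bool, cantorInterval r n p

/-- The family `CS` of all symmetric Cantor sets. -/
def CS : Set (Set ℝ) :=
  {C | ∃ r : ℕ → ℝ, IsAdmissible r ∧ C = symmCantor r}

/-- The family `M(f)` of all `C(r)` such that for every `ε > 0` there are infinitely many `n` with
`r n < ε ^ f n`. -/
def M (f : ℕ → ℝ) : Set (Set ℝ) :=
  {C | ∃ r : ℕ → ℝ, IsAdmissible r ∧ C = symmCantor r ∧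
    ∀ ε : ℝ, 0 < ε → ∃ᶠ n in atTop, r n < ε ^ f n}

/-- A set of reals is microscopic if for every `ε > 0` it has a countable cover `E_1, E_2, …` with
`diam E_n < ε ^ n` for all `n ≥ 1`; here `E n` is the set `E_{n+1}`. The diameter is the
extended one, so that unbounded sets have infinite diameter. -/
def IsMicroscopic (A : Set ℝ) : Prop :=
  ∀ ε : ℝ, 0 < ε → ∃ E : ℕ → Set ℝ,
    A ⊆ ⋃ n, E n ∧ ∀ n, Metric.ediam (E n) < ENNReal.ofReal (ε ^ (n + 1))

end CantorMicro

namespace CantorMicro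

open MeasureTheory

/-! If `r n` lies below the `2 ^ n`-th power of a small number, the `2 ^ n` intervals of level `n`
form a microscopic cover. A cover may also mix levels: for `r n = exp (-2 ^ n)` no single level
suffices, but assigning different levels to different subtrees does. Conversely, a cover is limited
by mass. Under the fair-coin measure on digits, a set of diameter at most `r n` catches mass at most
`4 / 2 ^ n`. If `∑ log (r n) / 2 ^ n` converges, the cover with `ε = exp (-L)` catches total mass
`O(1 / L)`, so the set is not microscopic (`not_isMicroscopic_of_summable`). An eventual bound `r n
≥ ε ^ p ^ n` with `p < 2` forces this convergence, giving the second inclusion; the exponents `2 ^ n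
/ n ^ 2`, suitably normalised, also converge yet outgrow every `p ^ n`, giving strictness. Since `M
f` quantifies over representing sequences, refuting membership requires that the set determine `r`.
-/

/-- The word formed by the first `n` digits of an infinite binary sequence. -/
def initialWord (b : ℕ → Bool) (n : ℕ) : Fin n → Bool := fun i => b i

/-! ### Nested intervals along digit sequences -/

theorem exists_initialWord_eq {n : ℕ} (p : Fin n → Bool) : ∃ b, initialWord b n = p :=
  ⟨fun i => if h : i < n then p ⟨i, h⟩ else false, by ext i; simp [initialWord]⟩

theorem leftEnd_initialWord_succ (r : ℕ → ℝ) (b : ℕ → Bool) (n : ℕ) :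
    leftEnd r (n + 1) (initialWord b (n + 1)) =
      leftEnd r n (initialWord b n) + (if b n = true then r n - r (n + 1) else 0) := rfl

variable {r : ℕ → ℝ}

theorem antitone_cantorInterval_initialWord (hr : IsAdmissible r) (b : ℕ → Bool) :
    Antitone fun n => cantorInterval r n (initialWord b n) := by
  refine antitone_nat_of_succ_le fun n => ?_
  have h := hr.strictAnti (Nat.lt_succ_self n)
  refine Set.Icc_subset_Icc ?_ ?_ <;> rw [leftEnd_initialWord_succ] <;> split_ifs <;> linarith

theorem exists_forall_mem_cantorInterval (hr : IsAdmissible r) (b : ℕ → Bool) :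
    ∃ x, ∀ n, x ∈ cantorInterval r n (initialWord b n) :=
  ⟨_, Set.mem_iInter.1 (ciSup_mem_iInter_Icc_of_antitone_Icc
    (antitone_cantorInterval_initialWord hr b) fun n => by linarith [hr.pos n])⟩

theorem mem_symmCantor_of_forall_mem {b : ℕ → Bool} {x : ℝ}
    (h : ∀ n, x ∈ cantorInterval r n (initialWord b n)) : x ∈ symmCantor r :=
  Set.mem_iInter.2 fun n => Set.mem_iUnion.2 ⟨_, h n⟩

theorem exists_mem_cantorInterval_of_le (hr : IsAdmissible r) {x : ℝ} (hx : x ∈ symmCantor r)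
    (N : ℕ) : ∃ b, ∀ n ≤ N, x ∈ cantorInterval r n (initialWord b n) := by
  obtain ⟨p, hp⟩ := Set.mem_iUnion.1 (Set.mem_iInter.1 hx N)
  obtain ⟨b, rfl⟩ := exists_initialWord_eq p
  exact ⟨b, fun n hn => antitone_cantorInterval_initialWord hr b hn hp⟩

/-! ### The sequence is determined by the Cantor set -/

theorem leftEnd_nonneg (hr : IsAdmissible r) (b : ℕ → Bool) (n : ℕ) :
    0 ≤ leftEnd r n (initialWord b n) := by
  induction n with
  | zero => exact le_rfl
  | succ n ih =>
    have h := hr.strictAnti (Nat.lt_succ_self n)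
    rw [leftEnd_initialWord_succ]
    split_ifs <;> linarith

theorem leftEnd_eq_zero_or_le (hr : IsAdmissible r) (b : ℕ → Bool) (n : ℕ) :
    leftEnd r n (initialWord b n) = 0 ∨ r n ≤ leftEnd r n (initialWord b n) := by
  induction n with
  | zero => exact Or.inl rfl
  | succ n ih =>
    have h := hr.strictAnti (Nat.lt_succ_self n)
    have h' := hr.le_half n
    have h0 := leftEnd_nonneg hr b n
    rw [leftEnd_initialWord_succ]
    split_ifs
    · right; linarith
    · rcases ih with ih | ih
      · left; linarith
      · right; linarith

theorem apply_mem_symmCantor (hr : IsAdmissible r) (m : ℕ) : r m ∈ symmCantor r := by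
  -- The digits of the right endpoint of the leftmost interval of level `m`.
  let b : ℕ → Bool := fun i => decide (m ≤ i)
  have key : ∀ n, (n ≤ m → leftEnd r n (initialWord b n) = 0) ∧
      (m ≤ n → leftEnd r n (initialWord b n) = r m - r n) := by
    intro n
    induction n with
    | zero =>
      refine ⟨fun _ => rfl, fun h => ?_⟩
      obtain rfl : m = 0 := by omega
      simp [leftEnd]
    | succ n ih =>
      rw [leftEnd_initialWord_succ]
      refine ⟨fun h => ?_, fun h => ?_⟩
      · have : ¬ m ≤ n := by omega
        simp [ih.1 (by omega), b, this]
      · rcases Nat.lt_or_ge n m with h' | h'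
        · obtain rfl : m = n + 1 := by omega
          rw [ih.1 (by omega)]
          simp [b]
        · simp [ih.2 h', b, h']
  refine mem_symmCantor_of_forall_mem (b := b) fun n => ?_
  have hm := hr.pos m
  have hn := hr.pos n
  rcases Nat.le_total n m with h | h
  · have := hr.strictAnti.antitone h
    simp only [cantorInterval, (key n).1 h, Set.mem_Icc]
    constructor <;> linarith
  · simp only [cantorInterval, (key n).2 h, Set.mem_Icc]
    constructor <;> linarith

theorem isGreatest_symmCantor (hr : IsAdmissible r) : IsGreatest (symmCantor r) (r 0) := by
  refine ⟨apply_mem_symmCantor hr 0, fun x hx => ?_⟩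
  obtain ⟨p, hp⟩ := Set.mem_iUnion.1 (Set.mem_iInter.1 hx 0)
  simpa [leftEnd] using hp.2

/-- This recovers `r (n + 1)` from the set and `r n`. Cutting at `r n / 2` leaves only the leftmost
interval of level `n + 1`, up to a touching point when `r (n + 1) = r n / 2`. -/
theorem isGreatest_symmCantor_inter_Iic (hr : IsAdmissible r) (n : ℕ) :
    IsGreatest (symmCantor r ∩ Set.Iic (r n / 2)) (r (n + 1)) := by
  refine ⟨⟨apply_mem_symmCantor hr _, hr.le_half n⟩, fun x hx => ?_⟩
  obtain ⟨b, hb⟩ := exists_mem_cantorInterval_of_le hr hx.1 (n + 1)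
  have hx1 := hb _ le_rfl
  have hx2 : x ≤ r n / 2 := hx.2
  rw [cantorInterval, Set.mem_Icc, leftEnd_initialWord_succ] at hx1
  have h := hr.le_half n
  have hn := hr.pos n
  have h0 := leftEnd_nonneg hr b n
  rcases leftEnd_eq_zero_or_le hr b n with h1 | h1 <;> split_ifs at hx1 <;> linarith [hx1.1, hx1.2]

theorem eq_of_symmCantor_eq {r s : ℕ → ℝ} (hr : IsAdmissible r) (hs : IsAdmissible s)
    (h : symmCantor r = symmCantor s) : r = s := by
  funext n
  induction n with
  | zero => exact (isGreatest_symmCantor hr).unique (h ▸ isGreatest_symmCantor hs)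
  | succ n ih =>
    have hs' := isGreatest_symmCantor_inter_Iic hs n
    rw [← h, ← ih] at hs'
    exact (isGreatest_symmCantor_inter_Iic hr n).unique hs'

theorem symmCantor_mem_M_iff (hr : IsAdmissible r) (f : ℕ → ℝ) :
    symmCantor r ∈ M f ↔ ∀ ε : ℝ, 0 < ε → ∃ᶠ n in atTop, r n < ε ^ f n := by
  refine ⟨?_, fun h => ⟨r, hr, rfl, h⟩⟩
  rintro ⟨s, hs, hrs, h⟩
  rwa [eq_of_symmCantor_eq hr hs hrs]

/-! ### Microscopic sets -/

theorem ediam_cantorInterval (n : ℕ) (p : Fin n → Bool) :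
    Metric.ediam (cantorInterval r n p) = ENNReal.ofReal (r n) := by
  simp [cantorInterval, Real.ediam_Icc]

/-- An enumeration of the binary words of length `n`. -/
noncomputable def wordEquiv (n : ℕ) : (Fin n → Bool) ≃ Fin (2 ^ n) :=
  Fintype.equivFinOfCardEq (by simp)

theorem isMicroscopic_of_frequently_lt
    (h : ∀ ε : ℝ, 0 < ε → ∃ᶠ n : ℕ in atTop, r n < ε ^ ((2 : ℝ) ^ n)) :
    IsMicroscopic (symmCantor r) := by
  intro ε hε
  -- Capping at 1 makes the powers decrease, so the last position is the most demanding.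
  obtain ⟨n, hn⟩ := (h (min ε 1) (by positivity)).exists
  refine ⟨fun k => if hk : k < 2 ^ n then
    cantorInterval r n ((wordEquiv n).symm ⟨k, hk⟩) else ∅, ?_, fun k => ?_⟩
  · intro x hx
    obtain ⟨p, hp⟩ := Set.mem_iUnion.1 (Set.mem_iInter.1 hx n)
    refine Set.mem_iUnion.2 ⟨wordEquiv n p, ?_⟩
    simpa using hp
  · dsimp only
    split_ifs with hk
    · rw [ediam_cantorInterval, ENNReal.ofReal_lt_ofReal_iff (by positivity)]
      have e : min ε 1 ^ ((2 : ℝ) ^ n) = min ε 1 ^ (2 ^ n) := by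
        have := Real.rpow_natCast (min ε 1) (2 ^ n)
        push_cast at this
        exact this
      rw [e] at hn
      calc r n < min ε 1 ^ (2 ^ n) := hn
        _ ≤ min ε 1 ^ (k + 1) :=
          pow_le_pow_of_le_one (by positivity) (min_le_right _ _) hk
        _ ≤ ε ^ (k + 1) := pow_le_pow_left₀ (by positivity) (min_le_left _ _) _
    · simpa using pow_pos hε _

/-- The position of the interval that covers the points with digits `b`: the first `d` digits
select a level `j`, and the following `j` digits select one of the `2 ^ j` positions
`2 ^ j, …, 2 ^ (j + 1) - 1` of that level. -/
noncomputable def coverIndex (d : ℕ) (b : ℕ → Bool) : ℕ :=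
  2 ^ (wordEquiv d (initialWord b d) : ℕ) +
    wordEquiv _ (initialWord (fun i => b (d + i)) (wordEquiv d (initialWord b d)))

theorem log_coverIndex (d : ℕ) (b : ℕ → Bool) :
    Nat.log 2 (coverIndex d b) = wordEquiv d (initialWord b d) := by
  rw [Nat.log_eq_iff (Or.inr ⟨one_lt_two, by unfold coverIndex; positivity⟩)]
  refine ⟨Nat.le_add_right _ _, ?_⟩
  rw [pow_succ, mul_two]
  exact Nat.add_lt_add_left (Fin.is_lt _) _

/-- Points sharing a position therefore share an interval of level `d + j`, which bounds the
diameter of the covering set. -/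
theorem initialWord_eq_of_coverIndex_eq {d : ℕ} {b c : ℕ → Bool}
    (h : coverIndex d b = coverIndex d c) :
    initialWord b (d + Nat.log 2 (coverIndex d b)) =
      initialWord c (d + Nat.log 2 (coverIndex d b)) := by
  have h1 : (wordEquiv d (initialWord b d) : ℕ) = wordEquiv d (initialWord c d) := by
    rw [← log_coverIndex, ← log_coverIndex, h]
  have h2 : initialWord b d = initialWord c d := (wordEquiv d).injective (Fin.ext h1)
  have h3 := h
  unfold coverIndex at h3
  rw [h2, Nat.add_left_cancel_iff] at h3
  have h4 := (wordEquiv _).injective (Fin.ext h3)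
  rw [log_coverIndex, h2]
  funext i
  rcases lt_or_ge (i : ℕ) d with hi | hi
  · exact congrFun h2 ⟨i, hi⟩
  · have := congrFun h4 ⟨i - d, by omega⟩
    simpa [initialWord, Nat.add_sub_cancel' hi] using this

theorem isMicroscopic_symmCantor_exp (hr : IsAdmissible fun n : ℕ => Real.exp (-2 ^ n)) :
    IsMicroscopic (symmCantor fun n : ℕ => Real.exp (-2 ^ n)) := by
  intro ε hε
  obtain ⟨m, hm⟩ : ∃ m : ℕ, -Real.log ε < 2 ^ m := pow_unbounded_of_one_lt _ one_lt_two
  have hε' : Real.exp (-2 ^ m) < ε := by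
    rw [← Real.lt_log_iff_exp_lt hε]; linarith
  set r : ℕ → ℝ := fun n => Real.exp (-2 ^ n) with hrdef
  -- With `d = m + 1` the extra digit absorbs the bound `k + 1 < 2 ^ (j + 1)`. Every level used is
  -- below `m + 1 + 2 ^ (m + 1)`, so finitely many digits suffice.
  refine ⟨fun k => {x | ∃ b, (∀ n ≤ m + 1 + 2 ^ (m + 1),
    x ∈ cantorInterval r n (initialWord b n)) ∧ coverIndex (m + 1) b = k + 1}, ?_, fun k => ?_⟩
  · intro x hx
    obtain ⟨b, hb⟩ := exists_mem_cantorInterval_of_le hr hx (m + 1 + 2 ^ (m + 1))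
    have : 0 < coverIndex (m + 1) b := by unfold coverIndex; positivity
    exact Set.mem_iUnion.2 ⟨coverIndex (m + 1) b - 1, b, hb, by omega⟩
  · set j := Nat.log 2 (k + 1) with hj
    have hlen : Metric.ediam {x | ∃ b, (∀ n ≤ m + 1 + 2 ^ (m + 1),
        x ∈ cantorInterval r n (initialWord b n)) ∧ coverIndex (m + 1) b = k + 1} ≤
          ENNReal.ofReal (r (m + 1 + j)) := by
      refine Metric.ediam_le ?_
      rintro x ⟨b, hb, hbk⟩ y ⟨c, hc, hck⟩
      have hjm : m + 1 + j ≤ m + 1 + 2 ^ (m + 1) := by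
        rw [hj, ← hbk, log_coverIndex]
        exact Nat.add_le_add_left (Fin.is_lt _).le _
      have heq := initialWord_eq_of_coverIndex_eq (hbk.trans hck.symm)
      rw [hbk, ← hj] at heq
      have hx := hb _ hjm
      have hy := hc _ hjm
      rw [← heq] at hy
      exact (Metric.edist_le_ediam_of_mem hx hy).trans (ediam_cantorInterval _ _).le
    refine hlen.trans_lt ?_
    rw [ENNReal.ofReal_lt_ofReal_iff (by positivity)]
    have hk : k + 1 < 2 ^ (j + 1) := Nat.lt_pow_succ_log_self one_lt_two _
    have hk' : ((k + 1 : ℕ) : ℝ) < 2 ^ (j + 1) := by exact_mod_cast hk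
    calc r (m + 1 + j) = Real.exp (-(2 ^ m * 2 ^ (j + 1))) := by
          simp only [hrdef]; ring_nf
      _ < Real.exp (((k + 1 : ℕ) : ℝ) * (-2 ^ m)) := by
          rw [Real.exp_lt_exp]
          have : (0 : ℝ) < 2 ^ m := by positivity
          nlinarith
      _ = Real.exp (-2 ^ m) ^ (k + 1) := Real.exp_nat_mul _ _
      _ ≤ ε ^ (k + 1) := pow_le_pow_left₀ (Real.exp_pos _).le hε'.le _

/-! ### Sets that are not microscopic -/

theorem separated_leftEnd (hr : IsAdmissible r) (n : ℕ) (p q : Fin n → Bool) (hpq : p ≠ q) :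
    r n ≤ |leftEnd r n p - leftEnd r n q| := by
  induction n with
  | zero => exact absurd (Subsingleton.elim p q) hpq
  | succ n ih =>
    have h := hr.le_half n
    have h0 := hr.pos (n + 1)
    simp only [leftEnd]
    by_cases hi : Fin.init p = Fin.init q
    · have hl : p (Fin.last n) ≠ q (Fin.last n) := by
        intro hl
        apply hpq
        rw [← Fin.snoc_init_self p, ← Fin.snoc_init_self q, hi, hl]
      rw [hi, le_abs]
      cases hp : p (Fin.last n) <;> cases hq : q (Fin.last n) <;>
        simp only [hp, hq, ne_eq, not_true_eq_false] at hl
      · right; simp; linarith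
      · left; simp; linarith
    -- The last digits change the distance by at most `r n - r (n + 1)`, leaving `r (n + 1)`.
    · have := ih _ _ hi
      rw [le_abs] at this ⊢
      rcases this with this | this
      · left; split_ifs <;> linarith
      · right; split_ifs <;> linarith

theorem card_words_le_four (hr : IsAdmissible r) (n : ℕ) (y : ℝ) (P : Finset (Fin n → Bool))
    (hP : ∀ p ∈ P, y - 2 * r n ≤ leftEnd r n p ∧ leftEnd r n p ≤ y + r n) : P.card ≤ 4 := by
  have hn := hr.pos n
  have : P.card ≤ (Finset.Icc (-2 : ℤ) 1).card := by
    refine Finset.card_le_card_of_injOn (fun p => ⌊(leftEnd r n p - y) / r n⌋) ?_ ?_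
    · intro p hp
      obtain ⟨h1, h2⟩ := hP p hp
      simp only [Finset.coe_Icc, Set.mem_Icc]
      constructor
      · rw [Int.le_floor, le_div_iff₀ hn]; push_cast; linarith
      · rw [← Int.lt_add_one_iff, Int.floor_lt, div_lt_iff₀ hn]; push_cast; linarith
    · intro p _ q _ hpq
      by_contra hne
      have h1 := Int.abs_sub_lt_one_of_floor_eq_floor hpq
      rw [← sub_div, abs_div, abs_of_pos hn, div_lt_one hn, sub_sub_sub_cancel_right] at h1
      exact absurd (separated_leftEnd hr n p q hne) (not_le.2 h1)
  simpa using this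

/-- The distribution of an infinite sequence of independent fair coin tosses. -/
noncomputable def coinMeasure : Measure (ℕ → Bool) :=
  Measure.infinitePi fun _ => (PMF.uniformOfFintype Bool).toMeasure

instance : IsProbabilityMeasure coinMeasure := by unfold coinMeasure; infer_instance

theorem coinMeasure_initialWord_eq (n : ℕ) (p : Fin n → Bool) :
    coinMeasure {b | initialWord b n = p} = 2⁻¹ ^ n := by
  obtain ⟨c, rfl⟩ := exists_initialWord_eq p
  have : {b | initialWord b n = initialWord c n} =
      Set.pi (Finset.range n : Finset ℕ) fun i => {c i} := by
    ext b
    simp only [Set.mem_ofPred_eq, funext_iff, initialWord, Set.mem_pi, Finset.coe_range,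
      Set.mem_Iio, Set.mem_singleton_iff]
    exact ⟨fun h i hi => h ⟨i, hi⟩, fun h i => h i i.2⟩
  rw [this, coinMeasure, Measure.infinitePi_pi _ fun _ _ => measurableSet_singleton _]
  simp

/-- Left endpoints of the intervals concerned lie in a window of length `3 * r n` and are `r
n`-separated, so at most four words occur. Only monotonicity and subadditivity are used, so `x` need
not be measurable. -/
theorem coinMeasure_preimage_le (hr : IsAdmissible r) {x : (ℕ → Bool) → ℝ}
    (hx : ∀ b n, x b ∈ cantorInterval r n (initialWord b n)) (n : ℕ) {S : Set ℝ}
    (hS : Metric.ediam S ≤ ENNReal.ofReal (r n)) : coinMeasure (x ⁻¹' S) ≤ 4 * 2⁻¹ ^ n := by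
  classical
  rcases (x ⁻¹' S).eq_empty_or_nonempty with h0 | ⟨c, hc⟩
  · simp [h0]
  have hn := hr.pos n
  let P : Finset (Fin n → Bool) := {p | ∃ b, x b ∈ S ∧ initialWord b n = p}
  have hP : P.card ≤ 4 := by
    refine card_words_le_four hr n (x c) P fun p hp => ?_
    obtain ⟨b, hb, rfl⟩ := (Finset.mem_filter.1 hp).2
    have h1 := (Metric.edist_le_ediam_of_mem hb hc).trans hS
    rw [edist_le_ofReal hn.le, Real.dist_eq, abs_le] at h1
    have h2 := hx b n
    rw [cantorInterval, Set.mem_Icc] at h2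
    constructor <;> linarith [h1.1, h1.2, h2.1, h2.2]
  have hsub : x ⁻¹' S ⊆ ⋃ p ∈ P, {b | initialWord b n = p} := fun b hb =>
    Set.mem_biUnion (Finset.mem_filter.2 ⟨Finset.mem_univ _, b, hb, rfl⟩) rfl
  calc coinMeasure (x ⁻¹' S) ≤ ∑ p ∈ P, coinMeasure {b | initialWord b n = p} :=
        (measure_mono hsub).trans (measure_biUnion_finset_le _ _)
    _ = P.card * 2⁻¹ ^ n := by simp [coinMeasure_initialWord_eq]
    _ ≤ 4 * 2⁻¹ ^ n := by gcongr; exact_mod_cast hP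

theorem two_inv_pow_le_tsum (N : ℕ) :
    (2⁻¹ : ENNReal) ^ N ≤ ∑' n, if N ≤ n then 2⁻¹ ^ (n + 1) else 0 := by
  calc (2⁻¹ : ENNReal) ^ N = ∑' m : ℕ, 2⁻¹ ^ N * 2⁻¹ ^ (m + 1) := by
        rw [ENNReal.tsum_mul_left, ENNReal.tsum_geometric_add_one, ENNReal.one_sub_inv_two,
          inv_inv, ENNReal.inv_mul_cancel two_ne_zero ENNReal.ofNat_ne_top, mul_one]
    _ = ∑' m : ℕ, if N ≤ N + m then (2⁻¹ : ENNReal) ^ (N + m + 1) else 0 := by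
        refine tsum_congr fun m => ?_
        rw [if_pos (Nat.le_add_right _ _), ← pow_add, add_assoc]
    _ ≤ _ := ENNReal.tsum_comp_le_tsum_of_injective (add_right_injective N)
        fun n => if N ≤ n then (2⁻¹ : ENNReal) ^ (n + 1) else 0

theorem exists_le_lt_succ_of_tendsto {l : ℕ → ℝ} (hl : Tendsto l atTop atTop) {y : ℝ}
    (h0 : l 0 ≤ y) : ∃ n, l n ≤ y ∧ y < l (n + 1) := by
  by_contra! h
  have : ∀ n, l n ≤ y := fun n => Nat.rec h0 h n
  obtain ⟨n, hn⟩ := (hl.eventually_gt_atTop y).exists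
  exact absurd (this n) (not_le.2 hn)

/-- The sum of `2⁻¹ ^ N k` over `k`, counted according to the values of `N`. -/
theorem tsum_two_inv_pow_le {l : ℕ → ℝ} (hl : Monotone l) {L : ℝ} (hL : 0 < L)
    (hs : Summable fun n => l n / 2 ^ n) {N : ℕ → ℕ}
    (hN : ∀ k : ℕ, L * (k + 1) < l (N k + 1)) :
    ∑' k, (2⁻¹ : ENNReal) ^ N k ≤ ENNReal.ofReal ((∑' n, |l (n + 1) / 2 ^ (n + 1)|) / L) := by
  have hs' : Summable fun n => |l (n + 1) / 2 ^ (n + 1)| := ((summable_nat_add_iff 1).2 hs).abs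
  calc ∑' k, (2⁻¹ : ENNReal) ^ N k
      ≤ ∑' k, ∑' n, if N k ≤ n then (2⁻¹ : ENNReal) ^ (n + 1) else 0 :=
        ENNReal.tsum_le_tsum fun k => two_inv_pow_le_tsum _
    _ = ∑' n, ∑' k, if N k ≤ n then (2⁻¹ : ENNReal) ^ (n + 1) else 0 := ENNReal.tsum_comm
    _ ≤ ∑' n, ENNReal.ofReal (|l (n + 1) / 2 ^ (n + 1)| / L) := by
        refine ENNReal.tsum_le_tsum fun n => ?_
        -- `N k ≤ n` gives `L * (k + 1) < l (n + 1)` by monotonicity, so at most `|l (n + 1)| / L`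
        -- indices contribute.
        have hk : ∀ k ∉ Finset.range ⌊|l (n + 1)| / L⌋₊,
            (if N k ≤ n then (2⁻¹ : ENNReal) ^ (n + 1) else 0) = 0 := by
          intro k hk
          rw [if_neg]
          intro hkn
          apply hk
          rw [Finset.mem_range, ← Nat.succ_le_iff]
          refine Nat.le_floor ?_
          rw [le_div_iff₀ hL, mul_comm]
          push_cast
          exact (hN k).le.trans ((hl (Nat.succ_le_succ hkn)).trans (le_abs_self _))
        rw [tsum_eq_sum hk]
        calc ∑ k ∈ Finset.range ⌊|l (n + 1)| / L⌋₊,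
              (if N k ≤ n then (2⁻¹ : ENNReal) ^ (n + 1) else 0)
            ≤ ∑ k ∈ Finset.range ⌊|l (n + 1)| / L⌋₊, (2⁻¹ : ENNReal) ^ (n + 1) :=
              Finset.sum_le_sum fun k _ => by split_ifs <;> simp
          _ = ENNReal.ofReal (⌊|l (n + 1)| / L⌋₊ * 2⁻¹ ^ (n + 1)) := by
              rw [ENNReal.ofReal_mul (by positivity), ENNReal.ofReal_natCast,
                ENNReal.ofReal_pow (by norm_num), ENNReal.ofReal_inv_of_pos two_pos]
              simp
          _ ≤ ENNReal.ofReal (|l (n + 1) / 2 ^ (n + 1)| / L) := by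
              refine ENNReal.ofReal_le_ofReal ?_
              calc (⌊|l (n + 1)| / L⌋₊ : ℝ) * 2⁻¹ ^ (n + 1)
                  ≤ |l (n + 1)| / L * 2⁻¹ ^ (n + 1) := by
                    gcongr
                    exact Nat.floor_le (by positivity)
                _ = _ := by
                    rw [abs_div, abs_of_pos (by positivity : (0 : ℝ) < 2 ^ (n + 1)), inv_pow]
                    ring
    _ = _ := by
        rw [← ENNReal.ofReal_tsum_of_nonneg (fun n => by positivity) (hs'.div_const L),
          tsum_div_const]

theorem not_isMicroscopic_of_summable (hr : IsAdmissible r)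
    (hs : Summable fun n => Real.log (r n) / 2 ^ n) : ¬ IsMicroscopic (symmCantor r) := by
  intro hmic
  set l : ℕ → ℝ := fun n => -Real.log (r n) with hl
  have hmono : Monotone l := fun m n h =>
    neg_le_neg (Real.log_le_log (hr.pos n) (hr.strictAnti.antitone h))
  have htend : Tendsto l atTop atTop :=
    tendsto_neg_atBot_atTop.comp (Real.tendsto_log_nhdsGT_zero.comp
      (tendsto_nhdsWithin_iff.2 ⟨hr.tendsto_zero, Eventually.of_forall hr.pos⟩))
  have hs' : Summable fun n => l n / 2 ^ n := by simpa [hl, neg_div] using hs.neg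
  set T : ℝ := ∑' n, |l (n + 1) / 2 ^ (n + 1)| with hT
  have hT0 : 0 ≤ T := tsum_nonneg fun n => abs_nonneg _
  -- The bound `l 0` makes the levels `N k` exist; `4 * T + 1` makes the total mass `4 * T / L` less
  -- than 1.
  set L : ℝ := max (l 0) (4 * T + 1) with hLdef
  have hL : 4 * T + 1 ≤ L := le_max_right _ _
  have hL0 : 0 < L := by linarith
  have hex : ∀ k : ℕ, ∃ n, l n ≤ L * (k + 1) ∧ L * (k + 1) < l (n + 1) := fun k =>
    exists_le_lt_succ_of_tendsto htend <| (le_max_left _ _).trans <|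
      le_mul_of_one_le_right hL0.le (by linarith [k.cast_nonneg (α := ℝ)])
  choose N hN1 hN2 using hex
  obtain ⟨E, hcov, hE⟩ := hmic (Real.exp (-L)) (Real.exp_pos _)
  choose x hx using exists_forall_mem_cantorInterval hr
  have hEN : ∀ k, Metric.ediam (E k) ≤ ENNReal.ofReal (r (N k)) := by
    intro k
    refine (hE k).le.trans (ENNReal.ofReal_le_ofReal ?_)
    rw [← Real.exp_nat_mul, ← Real.le_log_iff_exp_le (hr.pos _)]
    have := hN1 k
    simp only [hl] at this
    push_cast
    linarith
  have huniv : (Set.univ : Set (ℕ → Bool)) ⊆ ⋃ k, x ⁻¹' E k := by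
    intro b _
    rw [← Set.preimage_iUnion]
    exact hcov (mem_symmCantor_of_forall_mem (hx b))
  have hle : (1 : ENNReal) ≤ ENNReal.ofReal (4 * (T / L)) :=
    calc (1 : ENNReal) = coinMeasure Set.univ := measure_univ.symm
      _ ≤ ∑' k, coinMeasure (x ⁻¹' E k) := (measure_mono huniv).trans (measure_iUnion_le _)
      _ ≤ ∑' k, 4 * 2⁻¹ ^ N k :=
        ENNReal.tsum_le_tsum fun k => coinMeasure_preimage_le hr hx _ (hEN k)
      _ = 4 * ∑' k, 2⁻¹ ^ N k := ENNReal.tsum_mul_left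
      _ ≤ 4 * ENNReal.ofReal (T / L) := by
        gcongr
        exact tsum_two_inv_pow_le hmono hL0 hs' hN2
      _ = ENNReal.ofReal (4 * (T / L)) := by
        rw [ENNReal.ofReal_mul (by norm_num), ENNReal.ofReal_ofNat]
  rw [ENNReal.one_le_ofReal, ← mul_div_assoc, one_le_div hL0] at hle
  linarith

theorem frequently_lt_of_isMicroscopic (hr : IsAdmissible r) (hmic : IsMicroscopic (symmCantor r))
    {p : ℝ} (hp0 : 0 < p) (hp2 : p < 2) {ε : ℝ} (hε : 0 < ε) :
    ∃ᶠ n : ℕ in atTop, r n < ε ^ (p ^ n) := by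
  by_contra h
  rw [not_frequently] at h
  refine not_isMicroscopic_of_summable hr ?_ hmic
  have hg1 : Summable fun n : ℕ => |Real.log ε| * (p / 2) ^ n :=
    (summable_geometric_of_lt_one (by positivity) (by linarith)).mul_left _
  have hg2 : Summable fun n : ℕ => |Real.log (r 0)| * (1 / 2) ^ n :=
    (summable_geometric_of_lt_one (by norm_num) (by norm_num)).mul_left _
  refine Summable.of_norm_bounded_eventually_nat (hg1.add hg2) ?_
  filter_upwards [h] with n hn
  rw [not_lt] at hn
  have h1 : p ^ n * Real.log ε ≤ Real.log (r n) := by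
    rw [← Real.log_rpow hε]
    exact Real.log_le_log (by positivity) hn
  -- `r n` may exceed 1, so the logarithm also needs an upper bound.
  have h2 : Real.log (r n) ≤ Real.log (r 0) :=
    Real.log_le_log (hr.pos n) (hr.strictAnti.antitone (Nat.zero_le n))
  have h3 : |Real.log (r n)| ≤ |Real.log ε| * p ^ n + |Real.log (r 0)| := by
    have hpn : 0 < p ^ n := pow_pos hp0 n
    have h4 := mul_le_mul_of_nonneg_left (neg_abs_le (Real.log ε)) hpn.le
    have h5 := mul_nonneg hpn.le (abs_nonneg (Real.log ε))
    have h6 := le_abs_self (Real.log (r 0))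
    have h7 := abs_nonneg (Real.log (r 0))
    rw [abs_le]
    constructor <;> linarith
  rw [Real.norm_eq_abs, abs_div, abs_of_pos (by positivity : (0 : ℝ) < 2 ^ n), div_pow, div_pow,
    one_pow]
  calc |Real.log (r n)| / 2 ^ n ≤ (|Real.log ε| * p ^ n + |Real.log (r 0)|) / 2 ^ n := by gcongr
    _ = _ := by ring

/-! ### The separating examples -/

theorem isAdmissible_exp_neg {g : ℕ → ℝ} (hg : ∀ n, g n + 1 ≤ g (n + 1)) :
    IsAdmissible fun n => Real.exp (-g n) where
  pos n := Real.exp_pos _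
  strictAnti := strictAnti_nat_of_succ_lt fun n => Real.exp_lt_exp.2 (by linarith [hg n])
  tendsto_zero := by
    refine Real.tendsto_exp_atBot.comp (tendsto_neg_atTop_atBot.comp ?_)
    have h : ∀ n : ℕ, g 0 + n ≤ g n := by
      intro n
      induction n with
      | zero => simp
      | succ n ih => push_cast; linarith [hg n]
    exact tendsto_atTop_mono h (tendsto_atTop_add_const_left _ _ tendsto_natCast_atTop_atTop)
  le_half n := by
    have h2 : (2 : ℝ) ≤ Real.exp 1 := by linarith [Real.add_one_le_exp (1 : ℝ)]
    rw [le_div_iff₀ two_pos]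
    calc Real.exp (-g (n + 1)) * 2 ≤ Real.exp (-g (n + 1)) * Real.exp 1 := by gcongr
      _ = Real.exp (-g (n + 1) + 1) := (Real.exp_add _ _).symm
      _ ≤ Real.exp (-g n) := Real.exp_le_exp.2 (by linarith [hg n])

theorem isAdmissible_exp_neg_two_pow : IsAdmissible fun n : ℕ => Real.exp (-2 ^ n) :=
  isAdmissible_exp_neg fun n => by
    have : (1 : ℝ) ≤ 2 ^ n := one_le_pow₀ one_le_two
    rw [pow_succ]
    linarith

theorem symmCantor_exp_neg_two_pow_notMem_M :
    symmCantor (fun n : ℕ => Real.exp (-2 ^ n)) ∉ M fun n : ℕ => (2 : ℝ) ^ n := by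
  rw [symmCantor_mem_M_iff isAdmissible_exp_neg_two_pow]
  intro h
  obtain ⟨n, hn⟩ := (h (Real.exp (-1)) (Real.exp_pos _)).exists
  rw [← Real.exp_mul, neg_one_mul] at hn
  exact lt_irrefl _ hn

/-- An exponent growing slightly more slowly than `2 ^ n`. -/
noncomputable def slowExponent (n : ℕ) : ℝ := 64 * 2 ^ n / (n + 4) ^ 2

/-- The shift by 4 and the factor 64 make the increments at least 1 already from `n = 0`, so the
ratios of `exp (-slowExponent n)` are at most `1 / e < 1 / 2`. -/
theorem slowExponent_add_one_le (n : ℕ) : slowExponent n + 1 ≤ slowExponent (n + 1) := by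
  have h : (n + 5 : ℝ) ^ 2 ≤ 28 * 2 ^ n := by
    induction n with
    | zero => norm_num
    | succ n ih =>
      push_cast
      rw [pow_succ (2 : ℝ)]
      nlinarith [n.cast_nonneg (α := ℝ)]
  have hn : (0 : ℝ) ≤ n := n.cast_nonneg
  have h1 : (n + 4 : ℝ) ^ 2 * 7 ≤ 16 * (2 * (n + 4) ^ 2 - (n + 5) ^ 2) := by nlinarith
  have h2 : (n + 4 : ℝ) ^ 2 * (n + 5) ^ 2 ≤ 64 * 2 ^ n * (2 * (n + 4) ^ 2 - (n + 5) ^ 2) :=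
    calc (n + 4 : ℝ) ^ 2 * (n + 5) ^ 2 ≤ (n + 4 : ℝ) ^ 2 * (28 * 2 ^ n) := by gcongr
      _ = 4 * 2 ^ n * ((n + 4 : ℝ) ^ 2 * 7) := by ring
      _ ≤ 4 * 2 ^ n * (16 * (2 * (n + 4) ^ 2 - (n + 5) ^ 2)) := by gcongr
      _ = _ := by ring
  have h3 : slowExponent (n + 1) - slowExponent n =
      64 * 2 ^ n * (2 * (n + 4) ^ 2 - (n + 5) ^ 2) / ((n + 4 : ℝ) ^ 2 * (n + 5) ^ 2) := by
    simp only [slowExponent]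
    push_cast
    rw [show (n + 1 + 4 : ℝ) = n + 5 by ring]
    field_simp
    ring
  have h4 : 1 ≤ slowExponent (n + 1) - slowExponent n := by
    rw [h3, one_le_div (by positivity)]
    exact h2
  linarith

theorem isAdmissible_exp_neg_slowExponent : IsAdmissible fun n => Real.exp (-slowExponent n) :=
  isAdmissible_exp_neg slowExponent_add_one_le

theorem not_isMicroscopic_exp_neg_slowExponent :
    ¬ IsMicroscopic (symmCantor fun n => Real.exp (-slowExponent n)) := by
  refine not_isMicroscopic_of_summable isAdmissible_exp_neg_slowExponent ?_
  have h : Summable fun n : ℕ => -64 * (1 / ((n + 4 : ℕ) : ℝ) ^ 2) :=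
    ((summable_nat_add_iff 4).2 (Real.summable_one_div_nat_pow.2 one_lt_two)).mul_left _
  refine h.congr fun n => ?_
  simp only [slowExponent, Real.log_exp]
  push_cast
  field_simp

theorem symmCantor_exp_neg_slowExponent_mem_M {p : ℝ} (hp0 : 0 < p) (hp2 : p < 2) :
    symmCantor (fun n => Real.exp (-slowExponent n)) ∈ M fun n : ℕ => p ^ n := by
  rw [symmCantor_mem_M_iff isAdmissible_exp_neg_slowExponent]
  intro ε hε
  have hc : 0 < p / 2 := by positivity
  have ht : Tendsto (fun n : ℕ => ((n + 4 : ℕ) : ℝ) ^ 2 * (p / 2) ^ (n + 4)) atTop (𝓝 0) :=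
    (tendsto_add_atTop_iff_nat (f := fun n : ℕ => (n : ℝ) ^ 2 * (p / 2) ^ n) 4).2
      (tendsto_pow_const_mul_const_pow_of_lt_one 2 hc.le (by linarith))
  -- The factor `(p / 2) ^ 4` cancels the index shift; the added 1 keeps the divisor positive and
  -- the final inequality strict.
  have hev := ht.eventually_lt_const (u := 64 * (p / 2) ^ 4 / (|Real.log ε| + 1)) (by positivity)
  refine (hev.mono fun n hn => ?_).frequently
  rw [← Real.exp_log hε, ← Real.exp_mul, Real.exp_lt_exp, slowExponent]
  rw [lt_div_iff₀ (by positivity), pow_add] at hn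
  have h1 : ((n : ℝ) + 4) ^ 2 * (p / 2) ^ n * (|Real.log ε| + 1) < 64 := by
    refine lt_of_mul_lt_mul_right ?_ (pow_pos hc 4).le
    push_cast at hn
    linarith
  have h2 : p ^ n * (|Real.log ε| + 1) < 64 * 2 ^ n / (n + 4) ^ 2 := by
    rw [lt_div_iff₀ (by positivity)]
    calc p ^ n * (|Real.log ε| + 1) * ((n : ℝ) + 4) ^ 2
        = ((n : ℝ) + 4) ^ 2 * (p / 2) ^ n * (|Real.log ε| + 1) * 2 ^ n := by
          rw [div_pow]; field_simp
      _ < 64 * 2 ^ n := by gcongr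
  have h3 := mul_le_mul_of_nonneg_left (neg_abs_le (Real.log ε)) (pow_pos hp0 n).le
  have h4 := pow_pos hp0 n
  linarith

end CantorMicro

open CantorMicro in
theorem mainTheorem12 :
    CantorMicro.M (fun n : ℕ => (2 : ℝ) ^ n) ⊂
        {A : Set ℝ | CantorMicro.IsMicroscopic A} ∩ CantorMicro.CS ∧
      {A : Set ℝ | CantorMicro.IsMicroscopic A} ∩ CantorMicro.CS ⊂
        ⋂ p ∈ Set.Ioo (1 : ℝ) 2, CantorMicro.M (fun n : ℕ => p ^ n) := by
  refine ⟨⟨?_, fun h => ?_⟩, ⟨?_, fun h => ?_⟩⟩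
  · rintro _ ⟨r, hr, rfl, h⟩
    exact ⟨isMicroscopic_of_frequently_lt h, r, hr, rfl⟩
  · exact symmCantor_exp_neg_two_pow_notMem_M (h
      ⟨isMicroscopic_symmCantor_exp isAdmissible_exp_neg_two_pow,
        _, isAdmissible_exp_neg_two_pow, rfl⟩)
  · rintro _ ⟨hmic, r, hr, rfl⟩
    refine Set.mem_iInter₂.2 fun p hp => ⟨r, hr, rfl, fun ε hε => ?_⟩
    exact frequently_lt_of_isMicroscopic hr hmic (one_pos.trans hp.1) hp.2 hε
  · exact not_isMicroscopic_exp_neg_slowExponent (h (Set.mem_iInter₂.2 fun p hp =>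
      symmCantor_exp_neg_slowExponent_mem_M (one_pos.trans hp.1) hp.2)).1
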